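/- Let $\omega=e^{2\pi i/3}$, $\theta=2\cos(2\pi/7)=\zeta_7+\zeta_7^{-1}$ with $\zeta_7=e^{2\pi i/7}$, $\mathbb K=\mathbb Q(\omega)$, $\mathbb L=\mathbb Q(\omega,\theta)\subset\mathbb C$, let $\mathcal O_{\mathbb L}$ be the ring of integers of $\mathbb L$, let $\sigma$ be the $\mathbb K$-automorphism of $\mathbb L$ with $\sigma(\zeta_7+\zeta_7^{-1})=\zeta_7^2+\zeta_7^{-2}$, and put $\gamma=\omega$, $\alpha=1+\omega+\theta$. For $x=(x_0,x_1,x_2)\in\mathcal O_{\mathbb L}^3$ let $$\mathbf X(x)=\begin{pmatrix}\alpha&&\\&\sigma(\alpha)&\\&&\sigma^2(\alpha)\end{pmatrix}\begin{pmatrix}x_0&x_1&x_2\\ \gamma\sigma(x_2)&\sigma(x_0)&\sigma(x_1)\\ \gamma\sigma^2(x_1)&\gamma\sigma^2(x_2)&\sigma^2(x_0)\end{pmatrix}$$ be the corresponding codeword of the $3\times3$ perfect space-time block code (up to a scaling factor, which does not affect what follows). Let $\mathfrak q_1,\dots,\mathfrak q_K$ be nonzero, pairwise relatively prime ideals of $\mathcal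 O_{\mathbb L}$, $\mathfrak q=\mathfrak q_1\cdots\mathfrak q_K$, and $q_k=|\mathcal O_{\mathbb L}/\mathfrak q_k|$. Let $e:\prod_k\mathcal O_{\mathbb L}/\mathfrak q_k\to\mathcal O_{\mathbb L}/\mathfrak q$ be a ring isomorphism, and let $\mathcal M$ be $e$ followed by the choice of a complete set of coset leaders of $\mathcal O_{\mathbb L}/\mathfrak q$ in $\mathcal O_{\mathbb L}$ (in particular, leaders of minimum energy are allowed). The $k$-th message is $w_k=(w_{k,0},w_{k,1},w_{k,2})\in(\mathcal O_{\mathbb L}/\mathfrak q_k)^3$, and the LSTIC encoder is $$\phi(w_1,\dots,w_K)=\mathbf X(x_0,x_1,x_2),\qquad x_\ell=\mathcal M(w_{1,\ell},\dots,w_{K,\ell}).$$ The rate of the $k$-th message, in bits per real symbol, is $R_k=\frac1{2\cdot3^2}\log_2(q_k^3)$, and $R_{\mathcal S}=\sum_{s\in\mathcal S}R_s$ for $\mathcal S\subseteq\{1,\dots,K\}$. Given messages $v=(v_1,\dots,v_K)$, the codebook $\mathcal C$ is the set of all $\phi(d)$, and the subcode $\mathcal C_{\mathcal S}$ is the set of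 all $\phi(d)$ with $d_s=v_s$ for $s\in\mathcal S$. Let $\Lambda_{\mathcal S}$ be the (translated) lattice from which $\mathcal C_{\mathcal S}$ is carved: the set of all $\mathbf X(x)$, $x\in\mathcal O_{\mathbb L}^3$, such that for all $\ell$ and all $s\in\mathcal S$ the $s$-th component of $e^{-1}(x_\ell\bmod\mathfrak q)$ is $v_{s,\ell}$; thus $\Lambda_\emptyset=\{\mathbf X(x):x\in\mathcal O_{\mathbb L}^3\}$ is the lattice from which $\mathcal C$ is carved. For a set $\mathcal D$ of $3\times 3$ matrices let $$\delta(\mathcal D)=\inf_{\mathbf X\ne\mathbf X'\in\mathcal D}\det\big((\mathbf X-\mathbf X')(\mathbf X-\mathbf X')^\dagger\big).$$ The minimum determinants of $\mathcal C$ and $\mathcal C_{\mathcal S}$ are, by the usual convention for codes carved from lattices, $\delta(\Lambda_\emptyset)$ and $\delta(\Lambda_{\mathcal S})$, and the normalized side information gain is $$\Gamma(\mathcal C,\mathcal S)=\frac{10\log_{10}\big(\delta(\Lambda_{\mathcal S})/\delta(\Lambda_\emptyset)\big)}{3R_{\mathcal S}} .$$ **Corollary (LSTIC based on the $3\times3$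 perfect STBC).** The encoder $\phi$ is injective, $\mathcal C\subseteq\Lambda_\emptyset$, and for every $\mathcal S\subseteq\{1,\dots,K\}$ such that $\mathfrak q_s\neq\mathcal O_{\mathbb L}$ for some $s\in\mathcal S$, and for all values $v$ of the side information: $\mathcal C_{\mathcal S}\subseteq\Lambda_{\mathcal S}$, $R_{\mathcal S}>0$, the infima $\delta(\Lambda_\emptyset)>0$ and $\delta(\Lambda_{\mathcal S})$ are attained, and $$\Gamma(\mathcal C,\mathcal S)=20\log_{10}2\approx 6\ \text{dB per bit per real symbol}.$$ In particular, if the finite codebooks satisfy $\delta(\mathcal C)=\delta(\Lambda_\emptyset)$ and $\delta(\mathcal C_{\mathcal S})=\delta(\Lambda_{\mathcal S})$, then $\dfrac{10\log_{10}(\delta(\mathcal C_{\mathcal S})/\delta(\mathcal C))}{3R_{\mathcal S}}=20\log_{10}2$ as well. -/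

import Mathlib

open scoped NumberField Matrix

namespace PerfectCode

/-- The primitive cube root of unity `ω = exp(2πi/3)`. -/
noncomputable def omega : ℂ := Complex.exp (2 * Real.pi * Complex.I / 3)

/-- The base field `K = ℚ(ω)`, as a subfield of `ℂ`. -/
noncomputable abbrev K : IntermediateField ℚ ℂ := IntermediateField.adjoin ℚ {omega}

/-- The real number `θ = ζ₇ + ζ₇⁻¹ = 2 cos(2π/7)`, seen in `ℂ`. -/
noncomputable def theta : ℂ := ((2 * Real.cos (2 * Real.pi / 7) : ℝ) : ℂ)

/-- The field `L = K(θ) = ℚ(ω, θ)`, as a subfield of `ℂ`. -/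
noncomputable abbrev L : IntermediateField K ℂ := IntermediateField.adjoin K {theta}

/-- `ω` as an element of `L`. -/
noncomputable def omegaL : L :=
  algebraMap K L ⟨omega, IntermediateField.mem_adjoin_simple_self ℚ omega⟩

/-- `θ` as an element of `L`. -/
noncomputable def thetaL : L := ⟨theta, IntermediateField.mem_adjoin_simple_self K theta⟩

/-- The primitive seventh root of unity `ζ₇ = exp(2πi/7)`. -/
noncomputable def zeta : ℂ := Complex.exp (2 * Real.pi * Complex.I / 7)

theorem zeta_primitive : IsPrimitiveRoot zeta 7 := by
  have := Complex.isPrimitiveRoot_exp 7 (by norm_num)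
  simpa [zeta] using this

theorem theta_eq : theta = zeta + zeta⁻¹ := by
  unfold theta zeta
  rw [← Complex.exp_neg]
  push_cast
  rw [Complex.two_cos]
  congr 2 <;> ring

theorem theta_root : theta ^ 3 + theta ^ 2 - 2 * theta - 1 = 0 := by
  have h0 : zeta ≠ 0 := zeta_primitive.ne_zero (by norm_num)
  have h := zeta_primitive.geom_sum_eq_zero (by norm_num)
  simp only [Finset.sum_range_succ, Finset.sum_range_zero] at h
  rw [theta_eq]
  field_simp
  linear_combination h

/-- The polynomial `X³ + X² - 2X - 1` over `ℤ`. -/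
noncomputable def cubic : Polynomial ℤ :=
  Polynomial.X ^ 3 + Polynomial.X ^ 2 - 2 * Polynomial.X - 1

theorem cubic_natDegree : cubic.natDegree = 3 := by unfold cubic; compute_degree!

theorem cubic_monic : cubic.Monic := by unfold cubic; monicity!

theorem cubic_irreducible_rat : Irreducible (cubic.map (algebraMap ℤ ℚ)) := by
  have hm := cubic_monic.map (algebraMap ℤ ℚ)
  have hd : (cubic.map (algebraMap ℤ ℚ)).natDegree = 3 := by
    rw [cubic_monic.natDegree_map, cubic_natDegree]
  rw [hm.irreducible_iff_roots_eq_zero_of_degree_le_three (by omega) (by omega)]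
  rw [Multiset.eq_zero_iff_forall_notMem]
  intro r hr
  have hr' : (Polynomial.aeval r) cubic = 0 := by
    have := (Polynomial.mem_roots'.1 hr).2
    rwa [Polynomial.IsRoot.def, Polynomial.eval_map_algebraMap] at this
  obtain ⟨z, rfl⟩ := isInteger_of_is_root_of_monic cubic_monic hr'
  have hz : z ^ 3 + z ^ 2 - 2 * z - 1 = 0 := by
    have h2 : ((z ^ 3 + z ^ 2 - 2 * z - 1 : ℤ) : ℚ) = 0 := by
      simp only [cubic, map_sub, map_add, map_pow, map_mul, Polynomial.aeval_X, map_one,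
        map_ofNat] at hr'
      simpa using hr'
    exact_mod_cast h2
  have hdvd : z ∣ 1 := ⟨z ^ 2 + z - 2, by linear_combination -hz⟩
  rcases Int.isUnit_iff.1 (isUnit_of_dvd_one hdvd) with h | h <;> subst h <;> norm_num at hz

theorem omega_integral : IsIntegral ℚ omega := by
  refine ⟨Polynomial.X ^ 3 - 1, by monicity!, ?_⟩
  have : omega ^ 3 = 1 := by
    have := (Complex.isPrimitiveRoot_exp 3 (by norm_num)).pow_eq_one
    simpa [omega] using this
  simp [this]

theorem K_finrank_le : Module.finrank ℚ K ≤ 2 := by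
  rw [IntermediateField.adjoin.finrank omega_integral]
  have hp : IsPrimitiveRoot omega 3 := by
    simpa [omega] using Complex.isPrimitiveRoot_exp 3 (by norm_num)
  have h := hp.geom_sum_eq_zero (by norm_num)
  simp only [Finset.sum_range_succ, Finset.sum_range_zero] at h
  have hd : (Polynomial.X ^ 2 + Polynomial.X + 1 : Polynomial ℚ).natDegree = 2 := by
    compute_degree!
  rw [← hd]
  apply Polynomial.natDegree_le_of_dvd
  · apply minpoly.dvd
    simp only [map_add, map_pow, Polynomial.aeval_X, map_one]
    linear_combination h
  · intro h0
    rw [h0] at hd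
    simp at hd

theorem cubic_irreducible : Irreducible (cubic.map (algebraMap ℤ K)) := by
  have hm := cubic_monic.map (algebraMap ℤ K)
  have hd : (cubic.map (algebraMap ℤ K)).natDegree = 3 := by
    rw [cubic_monic.natDegree_map, cubic_natDegree]
  rw [hm.irreducible_iff_roots_eq_zero_of_degree_le_three (by omega) (by omega)]
  rw [Multiset.eq_zero_iff_forall_notMem]
  intro r hr
  have hr' : (Polynomial.aeval r) (cubic.map (algebraMap ℤ ℚ)) = 0 := by
    have := (Polynomial.mem_roots'.1 hr).2
    rw [Polynomial.IsRoot.def, Polynomial.eval_map_algebraMap] at this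
    rwa [Polynomial.aeval_map_algebraMap]
  have hmin := minpoly.eq_of_irreducible_of_monic cubic_irreducible_rat hr'
    (cubic_monic.map (algebraMap ℤ ℚ))
  have : FiniteDimensional ℚ K := IntermediateField.adjoin.finiteDimensional omega_integral
  have h3 : (minpoly ℚ r).natDegree ≤ Module.finrank ℚ K := minpoly.natDegree_le r
  rw [← hmin, cubic_monic.natDegree_map, cubic_natDegree] at h3
  have := K_finrank_le
  omega

theorem theta_minpoly : minpoly K theta = cubic.map (algebraMap ℤ K) := by
  refine (minpoly.eq_of_irreducible_of_monic cubic_irreducible ?_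
    (cubic_monic.map (algebraMap ℤ K))).symm
  rw [Polynomial.aeval_map_algebraMap]
  simp only [cubic, map_sub, map_add, map_pow, map_mul, Polynomial.aeval_X, map_one, map_ofNat]
  exact theta_root

theorem theta_integral : IsIntegral K theta := by
  refine ⟨cubic.map (algebraMap ℤ K), cubic_monic.map _, ?_⟩
  rw [← theta_minpoly]
  exact minpoly.aeval K theta

/-- There is a `K`-automorphism of `L` taking `θ = ζ₇ + ζ₇⁻¹` to `ζ₇² + ζ₇⁻²`. -/
theorem exists_sigma : ∃ s : L ≃ₐ[K] L, ((s thetaL : L) : ℂ) = zeta ^ 2 + (zeta ^ 2)⁻¹ := by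
  have : FiniteDimensional K L := IntermediateField.adjoin.finiteDimensional theta_integral
  have hroot : thetaL ^ 3 + thetaL ^ 2 - 2 * thetaL - 1 = 0 := by
    apply Subtype.ext
    exact theta_root
  have h0 : Polynomial.aeval (thetaL ^ 2 - 2)
      (minpoly K (IntermediateField.adjoin.powerBasis theta_integral).gen) = 0 := by
    rw [IntermediateField.adjoin.powerBasis_gen, IntermediateField.minpoly_gen, theta_minpoly,
      Polynomial.aeval_map_algebraMap]
    simp only [cubic, map_sub, map_add, map_pow, map_mul, Polynomial.aeval_X, map_one, map_ofNat]
    linear_combination (thetaL ^ 3 - thetaL ^ 2 - 2 * thetaL + 1) * hroot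
  let f : L →ₐ[K] L := (IntermediateField.adjoin.powerBasis theta_integral).lift _ h0
  have hf : f thetaL = thetaL ^ 2 - 2 := by
    have := (IntermediateField.adjoin.powerBasis theta_integral).lift_gen _ h0
    rwa [IntermediateField.adjoin.powerBasis_gen] at this
  refine ⟨AlgEquiv.ofBijective f (Algebra.IsAlgebraic.algHom_bijective f), ?_⟩
  have hz : zeta ≠ 0 := zeta_primitive.ne_zero (by norm_num)
  rw [AlgEquiv.ofBijective_apply, hf]
  have : ((thetaL ^ 2 - 2 : L) : ℂ) = theta ^ 2 - 2 := by
    rfl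
  rw [this, theta_eq]
  field_simp
  ring

/-- The generator `σ` of `Gal(L/K)`: the `K`-automorphism with `σ(ζ₇ + ζ₇⁻¹) = ζ₇² + ζ₇⁻²`
(it is the only one, since `L = K(θ)`). -/
noncomputable def sigma : L ≃ₐ[K] L := exists_sigma.choose

theorem sigma_theta : ((sigma thetaL : L) : ℂ) = zeta ^ 2 + (zeta ^ 2)⁻¹ :=
  exists_sigma.choose_spec

/-- `α = 1 + ω + θ`. -/
noncomputable def alpha : L := 1 + omegaL + thetaL

/-- The matrix of `x₀ + x₁e + x₂e²` in the cyclic algebra `(L/K, σ, γ)` with `γ = ω`. -/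
noncomputable def layerMatrix (x : Fin 3 → L) : Matrix (Fin 3) (Fin 3) ℂ :=
  !![(x 0 : ℂ),                        x 1,                                x 2;
     omega * sigma (x 2),              sigma (x 0),                        sigma (x 1);
     omega * sigma (sigma (x 1)),      omega * sigma (sigma (x 2)),        sigma (sigma (x 0))]

/-- The codeword `D(α) · (matrix of x)`, with `D(α) = diag(α, σ(α), σ²(α))`. -/
noncomputable def codeword (x : Fin 3 → 𝓞 L) : Matrix (Fin 3) (Fin 3) ℂ :=
  Matrix.diagonal ![(alpha : ℂ), sigma alpha, sigma (sigma alpha)] *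
    layerMatrix fun l => (x l : L)

section Scheme

variable {k : ℕ} (q : Fin k → Ideal (𝓞 L))

/-- Messages: the `i`-th message has three sub-messages (one per layer) in `𝓞 L / q i`. -/
abbrev Message (i : Fin k) : Type := Fin 3 → 𝓞 L ⧸ q i

/-- The encoder: layer `l` carries the coset leader `lead (e (w₁ₗ, …, w_kₗ))`. -/
noncomputable def encode (e : (∀ i, 𝓞 L ⧸ q i) ≃+* 𝓞 L ⧸ ∏ i, q i)
    (lead : 𝓞 L ⧸ ∏ i, q i → 𝓞 L) (w : ∀ i, Message q i) : Matrix (Fin 3) (Fin 3) ℂ :=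
  codeword fun l => lead (e fun i => w i l)

/-- The finite subcode `C_S`: all codewords whose messages with index in `S` are those of `v`. For
`S = ∅` it is the whole codebook `C`. -/
def subcode (e : (∀ i, 𝓞 L ⧸ q i) ≃+* 𝓞 L ⧸ ∏ i, q i) (lead : 𝓞 L ⧸ ∏ i, q i → 𝓞 L)
    (S : Finset (Fin k)) (v : ∀ i, Message q i) : Set (Matrix (Fin 3) (Fin 3) ℂ) :=
  {X | ∃ d : ∀ i, Message q i, (∀ i ∈ S, d i = v i) ∧ X = encode q e lead d}

/-- The (translated) lattice from which `C_S` is carved: all the matrices obtained from arbitrary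
layer signals in `𝓞 L` (not only coset leaders) whose messages with index in `S` are those of `v`.
For `S = ∅` it is the whole lattice of matrices `codeword x`. -/
def latticeSubcode (e : (∀ i, 𝓞 L ⧸ q i) ≃+* 𝓞 L ⧸ ∏ i, q i)
    (S : Finset (Fin k)) (v : ∀ i, Message q i) : Set (Matrix (Fin 3) (Fin 3) ℂ) :=
  {X | ∃ x : Fin 3 → 𝓞 L,
    (∀ i ∈ S, ∀ l, e.symm (Ideal.Quotient.mk (∏ i, q i) (x l)) i = v i l) ∧ X = codeword x}

/-- The rate `R_S = ∑_{i ∈ S} R_i` with `R_i = log₂(M_i) / r`, where `M_i` is the number of values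
of the `i`-th message and `r = 2 · 3²` the number of real symbols per codeword. -/
noncomputable def rate (S : Finset (Fin k)) : ℝ :=
  ∑ i ∈ S, Real.logb 2 (Nat.card (Message q i)) / (2 * 3 ^ 2)

end Scheme

/-- The values `det((X - X')(X - X')†)` for `X ≠ X'` in a code. -/
def pairDets (C : Set (Matrix (Fin 3) (Fin 3) ℂ)) : Set ℝ :=
  {d | ∃ X ∈ C, ∃ X' ∈ C, X ≠ X' ∧ (d : ℂ) = ((X - X') * (X - X')ᴴ).det}

/-- The minimum determinant `δ(C)`. -/
noncomputable def minDet (C : Set (Matrix (Fin 3) (Fin 3) ℂ)) : ℝ := sInf (pairDets C)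

/-- The normalized side information gain `10 log₁₀(δ(C_S) / δ(C)) / (n_t R_S)` with `n_t = 3`. -/
noncomputable def gain (C CS : Set (Matrix (Fin 3) (Fin 3) ℂ)) (R : ℝ) : ℝ :=
  10 * Real.logb 10 (minDet CS / minDet C) / (3 * R)

end PerfectCode

namespace PerfectCode

/-! Every determinant here factors as det `codeword x` = N(α) · Nrd(x), with N = N_{L/K} and Nrd the
reduced norm of the cyclic algebra (L/K, σ, ω), and |N(α)|² = 7 (`det_codeword`,
`normSq_relNorm_alpha`). Three facts about L then give the result.

The algebra is a division algebra (`reducedNorm_ne_zero`). Modulo the prime (α) above 7, σ is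
trivial, ω becomes 4, and Nrd becomes the norm form of 𝔽₇(∛4), which is anisotropic because 4 is not
a cube. A zero of Nrd is therefore divisible by every power of α. Since Nrd(x) is an algebraic
integer fixed by σ, |Nrd(x)|² ≥ 1 for x ≠ 0.

The ring `𝓞 L` is principal: the Minkowski bound is below 9, the only possible prime norm below 9 is
7, and explicit generators exist there.

Fixing the messages in S confines each layer to a coset of an ideal (b) of norm N_S = ∏ q_s.
Differences are b • z, and Nrd(b • z) = N(b) Nrd(z), so the minimum determinant is exactly 7 N_S
(`isLeast_pairDets_cosetCode`). As R_S = log₂(N_S)/6, the gain does not depend on N_S. -/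

/-! ### The embeddings of K and L into ℂ -/

theorem omega_primitive : IsPrimitiveRoot omega 3 := by
  simpa [omega] using Complex.isPrimitiveRoot_exp 3 (by norm_num)

theorem omega_quad : omega ^ 2 + omega + 1 = 0 := by
  have h := omega_primitive.geom_sum_eq_zero (by norm_num)
  simp only [Finset.sum_range_succ, Finset.sum_range_zero] at h
  linear_combination h

theorem omegaL_quad : omegaL ^ 2 + omegaL + 1 = 0 := Subtype.ext omega_quad

theorem thetaL_root : thetaL ^ 3 + thetaL ^ 2 - 2 * thetaL - 1 = 0 := Subtype.ext theta_root

theorem omega_conj : (starRingEnd ℂ) omega = -1 - omega := by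
  have h1 : (starRingEnd ℂ) omega = omega⁻¹ := by
    unfold omega
    rw [← Complex.exp_conj, ← Complex.exp_neg]
    congr 1
    simp [Complex.conj_ofNat]
    ring
  have h0 : omega ≠ 0 := omega_primitive.ne_zero (by norm_num)
  rw [h1]
  field_simp
  linear_combination omega_quad

theorem omega_conj_ne : (starRingEnd ℂ) omega ≠ omega := by
  intro h
  have h1 := omega_conj
  have h2 := omega_quad
  have h3 : (3 : ℂ) = 0 := by
    rw [h] at h1
    -- A real ω would satisfy 2ω + 1 = 0, against 4(ω² + ω + 1) − (2ω + 1)² = 3.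
    linear_combination 4 * h2 - (2 * omega + 1) * h1
  norm_num at h3

instance : FiniteDimensional ℚ K := IntermediateField.adjoin.finiteDimensional omega_integral

instance : FiniteDimensional K L := IntermediateField.adjoin.finiteDimensional theta_integral

instance : FiniteDimensional ℚ L := FiniteDimensional.trans ℚ K L

instance : NumberField L where
  to_charZero := inferInstance
  to_finiteDimensional := inferInstance

theorem finrank_K_L : Module.finrank K L = 3 := by
  rw [IntermediateField.adjoin.finrank theta_integral, theta_minpoly, cubic_monic.natDegree_map,
    cubic_natDegree]

/-- The inclusion `K → ℂ`. -/
noncomputable def valK : K →ₐ[ℚ] ℂ := K.val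

/-- The complex conjugate of the inclusion `K → ℂ`. -/
noncomputable def conjK : K →ₐ[ℚ] ℂ := (Complex.conjAe.restrictScalars ℚ).toAlgHom.comp K.val

theorem conjK_apply (z : K) : conjK z = (starRingEnd ℂ) (z : ℂ) := rfl

theorem valK_apply (z : K) : valK z = (z : ℂ) := rfl

theorem valK_ne_conjK : valK ≠ conjK := by
  intro h
  have := DFunLike.congr_fun h ⟨omega, IntermediateField.mem_adjoin_simple_self ℚ omega⟩
  rw [conjK_apply, valK_apply] at this
  exact omega_conj_ne this.symm

theorem finrank_Q_K : Module.finrank ℚ K = 2 := by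
  refine le_antisymm K_finrank_le ?_
  rw [← AlgHom.card ℚ K ℂ]
  exact Fintype.one_lt_card_iff.2 ⟨_, _, valK_ne_conjK⟩

open Classical in
theorem embeddings_K : (Finset.univ : Finset (K →ₐ[ℚ] ℂ)) = {valK, conjK} := by
  symm
  rw [← Finset.card_eq_iff_eq_univ, AlgHom.card ℚ K ℂ, finrank_Q_K,
    Finset.card_pair valK_ne_conjK]

theorem finrank_Q_L : Module.finrank ℚ L = 6 := by
  rw [← Module.finrank_mul_finrank ℚ K L, finrank_Q_K, finrank_K_L]

theorem sigma_thetaL : sigma thetaL = thetaL ^ 2 - 2 := by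
  apply Subtype.ext
  rw [sigma_theta]
  change _ = theta ^ 2 - 2
  have hz : zeta ≠ 0 := zeta_primitive.ne_zero (by norm_num)
  rw [theta_eq]
  field_simp
  ring

theorem sigma_omegaL : sigma omegaL = omegaL := sigma.commutes _

theorem algHom_L_ext {A : Type*} [Ring A] [Algebra K A] {f g : L →ₐ[K] A}
    (h : f thetaL = g thetaL) : f = g := by
  refine (IntermediateField.adjoin.powerBasis theta_integral).algHom_ext ?_
  rw [IntermediateField.adjoin.powerBasis_gen]
  exact h

theorem sigma_sigma_thetaL : sigma (sigma thetaL) = 1 - thetaL - thetaL ^ 2 := by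
  simp only [sigma_thetaL, map_sub, map_pow, map_ofNat]
  linear_combination (thetaL - 1) * thetaL_root

theorem sigma_cubed (x : L) : sigma (sigma (sigma x)) = x := by
  have : (sigma.toAlgHom.comp (sigma.toAlgHom.comp sigma.toAlgHom)) = AlgHom.id K L := by
    apply algHom_L_ext
    change sigma (sigma (sigma thetaL)) = thetaL
    rw [sigma_sigma_thetaL]
    simp only [sigma_thetaL, map_sub, map_pow, map_one]
    linear_combination (1 - thetaL) * thetaL_root
  exact DFunLike.congr_fun this x

theorem sigma_thetaL_ne : sigma thetaL ≠ thetaL := by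
  intro h
  have h1 := sigma_thetaL
  rw [h] at h1
  -- Up to sign, 7 is the resultant of X² − X − 2 and the cubic, which would share the root θ.
  have h3 : (7 : L) = 0 := by
    linear_combination (-(4 + (2 * thetaL - 5) * (thetaL + 2))) * h1
      - (2 * thetaL - 5) * thetaL_root
  norm_num at h3

/-- The inclusion `L → ℂ` precomposed with the three powers of `σ`. -/
noncomputable def embL : Fin 3 → (L →ₐ[K] ℂ) :=
  ![L.val, L.val.comp sigma.toAlgHom, L.val.comp (sigma.toAlgHom.comp sigma.toAlgHom)]

theorem embL_injective : Function.Injective embL := by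
  have h01 := sigma_thetaL_ne
  have h12 : sigma (sigma thetaL) ≠ sigma thetaL := fun h => h01 (sigma.injective h)
  have h02 : sigma (sigma thetaL) ≠ thetaL := by
    intro h
    have := congrArg sigma h
    rw [sigma_cubed] at this
    exact h01 this.symm
  have key : ∀ i j, embL i = embL j → embL i thetaL = embL j thetaL := fun i j h => by rw [h]
  intro i j hij
  have := key i j hij
  fin_cases i <;> fin_cases j <;> simp [embL] at this ⊢
  · exact h01 this.symm
  · exact h02 this.symm
  · exact h01 this
  · exact h01 this.symm
  · exact h02 this
  · exact h01 this

theorem embL_bijective : Function.Bijective embL := by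
  rw [Fintype.bijective_iff_injective_and_card, AlgHom.card K L ℂ, finrank_K_L]
  exact ⟨embL_injective, by simp⟩

theorem coe_norm_K_L (x : L) :
    ((Algebra.norm K x : K) : ℂ) = (x * sigma x * sigma (sigma x) : L) := by
  have h := Algebra.norm_eq_prod_embeddings K ℂ x
  rw [← (Equiv.ofBijective embL embL_bijective).prod_comp, Fin.prod_univ_three] at h
  exact h

theorem coe_trace_K_L (x : L) :
    ((Algebra.trace K L x : K) : ℂ) = (x + sigma x + sigma (sigma x) : L) := by
  have h := trace_eq_sum_embeddings (K := K) ℂ (x := x)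
  rw [← (Equiv.ofBijective embL embL_bijective).sum_comp, Fin.sum_univ_three] at h
  exact h

theorem coe_norm_Q_K (z : K) :
    ((Algebra.norm ℚ z : ℚ) : ℂ) = z * (starRingEnd ℂ) (z : ℂ) := by
  classical
  have h := Algebra.norm_eq_prod_embeddings ℚ ℂ z
  rw [embeddings_K, Finset.prod_pair valK_ne_conjK] at h
  exact h

theorem coe_trace_Q_K (z : K) :
    ((Algebra.trace ℚ K z : ℚ) : ℂ) = z + (starRingEnd ℂ) (z : ℂ) := by
  classical
  have h := trace_eq_sum_embeddings (K := ℚ) ℂ (x := z)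
  rw [embeddings_K, Finset.sum_pair valK_ne_conjK] at h
  exact h

/-! ### Norms from L to ℚ -/

/-- The relative norm of `L` over `K`, with values in `L`. -/
noncomputable def relNorm (x : L) : L := x * sigma x * sigma (sigma x)

/-- Transitivity of the norm through K, where conjugation is complex conjugation and so N_{K/ℚ}(z) =
|z|². -/
theorem norm_eq_normSq (x : L) :
    ((Algebra.norm ℚ x : ℚ) : ℝ) = Complex.normSq (relNorm x : ℂ) := by
  have h := coe_norm_Q_K (Algebra.norm K x)
  rw [Algebra.norm_norm, coe_norm_K_L, Complex.mul_conj] at h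
  exact_mod_cast h

theorem absNorm_span_eq (b : 𝓞 L) :
    (Ideal.absNorm (Ideal.span {b}) : ℝ) = Complex.normSq (relNorm b : ℂ) := by
  rw [← norm_eq_normSq, Ideal.absNorm_span_singleton, ← Algebra.coe_norm_int]
  have h : 0 ≤ ((Algebra.norm ℤ b : ℤ) : ℝ) := by
    have := norm_eq_normSq (b : L)
    rw [← Algebra.coe_norm_int] at this
    push_cast at this
    rw [this]
    exact Complex.normSq_nonneg _
  have h' : 0 ≤ Algebra.norm ℤ b := by exact_mod_cast h
  have h2 : ((Algebra.norm ℤ b).natAbs : ℤ) = Algebra.norm ℤ b := Int.natAbs_of_nonneg h'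
  have h3 : (((Algebra.norm ℤ b).natAbs : ℤ) : ℝ) = ((Algebra.norm ℤ b : ℤ) : ℝ) := by rw [h2]
  rwa [Int.cast_natCast] at h3

/-! ### Traces, discriminant and Minkowski bound -/

/-- Power sums of the roots of the cubic, needed up to exponent 4 because the trace matrix pairs
exponents at most 2. -/
theorem sum_conj_pow_theta (j : Fin 5) :
    thetaL ^ (j : ℕ) + sigma thetaL ^ (j : ℕ) + sigma (sigma thetaL) ^ (j : ℕ) =
      ((![3, -1, 5, -4, 13] : Fin 5 → ℤ) j : L) := by
  have ha := thetaL_root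
  have hb : sigma thetaL ^ 3 + sigma thetaL ^ 2 - 2 * sigma thetaL - 1 = 0 := by
    simpa [map_ofNat sigma 2] using congrArg sigma ha
  have hc : sigma (sigma thetaL) ^ 3 + sigma (sigma thetaL) ^ 2 - 2 * sigma (sigma thetaL) - 1
      = 0 := by
    simpa [map_ofNat sigma 2] using congrArg sigma hb
  have h1 : thetaL + sigma thetaL + sigma (sigma thetaL) = -1 := by
    rw [sigma_sigma_thetaL, sigma_thetaL]; ring
  have hab := sigma_thetaL
  have hbc : sigma (sigma thetaL) = sigma thetaL ^ 2 - 2 := by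
    simpa [map_ofNat sigma 2] using congrArg sigma hab
  have hca : thetaL = sigma (sigma thetaL) ^ 2 - 2 := by
    simpa [sigma_cubed, map_ofNat sigma 2] using congrArg sigma hbc
  generalize sigma (sigma thetaL) = c at *
  generalize sigma thetaL = b at *
  generalize thetaL = a at *
  have h2 : a ^ 2 + b ^ 2 + c ^ 2 = 5 := by linear_combination h1 - hab - hbc - hca
  have h3 : a ^ 3 + b ^ 3 + c ^ 3 = -4 := by linear_combination ha + hb + hc - h2 + 2 * h1
  fin_cases j
  · norm_num
  · simpa using h1
  · simpa using h2
  · simpa using h3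
  · simp only
    push_cast
    linear_combination a * ha + b * hb + c * hc - h3 + 2 * h2 + h1

theorem sum_conj_pow_omega (i : Fin 3) :
    omega ^ (i : ℕ) + (-1 - omega) ^ (i : ℕ) = ((![2, -1, -1] : Fin 3 → ℤ) i : ℂ) := by
  fin_cases i
  · norm_num
  · simp
  · simp only
    push_cast
    linear_combination 2 * omega_quad

theorem trace_omega_theta (i : Fin 3) (j : Fin 5) :
    Algebra.trace ℚ L (omegaL ^ (i : ℕ) * thetaL ^ (j : ℕ)) =
      (((![2, -1, -1] : Fin 3 → ℤ) i * (![3, -1, 5, -4, 13] : Fin 5 → ℤ) j : ℤ) : ℚ) := by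
  have h1 : ((Algebra.trace K L (omegaL ^ (i : ℕ) * thetaL ^ (j : ℕ)) : K) : ℂ) =
      omega ^ (i : ℕ) * ((![3, -1, 5, -4, 13] : Fin 5 → ℤ) j : ℂ) := by
    rw [coe_trace_K_L]
    simp only [map_mul, map_pow, sigma_omegaL]
    rw [← mul_add, ← mul_add, sum_conj_pow_theta]
    simp [omegaL]
  have h2 := coe_trace_Q_K (Algebra.trace K L (omegaL ^ (i : ℕ) * thetaL ^ (j : ℕ)))
  rw [Algebra.trace_trace, h1, map_mul (starRingEnd ℂ), map_pow (starRingEnd ℂ), omega_conj, map_intCast, ← add_mul,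
    sum_conj_pow_omega] at h2
  exact_mod_cast h2

/-- `ω` as an algebraic integer of `L`. -/
noncomputable def omegaO : 𝓞 L :=
  ⟨omegaL, ⟨Polynomial.X ^ 2 + Polynomial.X + 1, by monicity!, by
    simpa using omegaL_quad⟩⟩

/-- `θ` as an algebraic integer of `L`. -/
noncomputable def thetaO : 𝓞 L :=
  ⟨thetaL, ⟨cubic, cubic_monic, by
    simpa [cubic] using thetaL_root⟩⟩

theorem omegaO_quad : omegaO ^ 2 + omegaO + 1 = 0 := by
  apply NumberField.RingOfIntegers.ext
  exact omegaL_quad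

theorem thetaO_root : thetaO ^ 3 + thetaO ^ 2 - 2 * thetaO - 1 = 0 := by
  apply NumberField.RingOfIntegers.ext
  exact thetaL_root

/-- The family `ω ^ i θ ^ j` of six integers of `L`. -/
noncomputable def family (a : Fin 2 × Fin 3) : 𝓞 L := omegaO ^ (a.1 : ℕ) * thetaO ^ (a.2 : ℕ)

theorem traceMatrix_family : Algebra.traceMatrix ℤ family =
    Matrix.kroneckerMap (· * ·) !![2, -1; -1, -1] !![3, -1, 5; -1, 5, -4; 5, -4, 13] := by
  ext ⟨i, j⟩ ⟨i', j'⟩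
  rw [Algebra.traceMatrix_apply, Algebra.traceForm_apply, Matrix.kroneckerMap_apply]
  have h : ((Algebra.trace ℤ (𝓞 L) (family (i, j) * family (i', j')) : ℤ) : ℚ) =
      ((![2, -1, -1] : Fin 3 → ℤ) ⟨i + i', by omega⟩ *
        (![3, -1, 5, -4, 13] : Fin 5 → ℤ) ⟨j + j', by omega⟩ : ℤ) := by
    rw [Algebra.coe_trace_int, ← trace_omega_theta]
    congr 1
    change omegaL ^ (i : ℕ) * thetaL ^ (j : ℕ) * (omegaL ^ (i' : ℕ) * thetaL ^ (j' : ℕ)) = _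
    ring
  rw [Int.cast_injective h]
  congr 1
  · fin_cases i <;> fin_cases i' <;> rfl
  · fin_cases j <;> fin_cases j' <;> rfl

/-- The Kronecker factors have determinants −3 and 49, so the value is (−3)³ · 49². -/
theorem discr_family : Algebra.discr ℤ family = -64827 := by
  rw [Algebra.discr_def, traceMatrix_family, Matrix.det_kronecker, Matrix.det_fin_two,
    Matrix.det_fin_three]
  simp

/-- The discriminant of `family` is a nonzero integer square times that of L. An upper bound
suffices for Minkowski, so `family` need not be shown to be an integral basis. -/
theorem abs_discr_le : |NumberField.discr L| ≤ 64827 := by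
  have e : Module.Free.ChooseBasisIndex ℤ (𝓞 L) ≃ Fin 2 × Fin 3 := by
    apply Fintype.equivOfCardEq
    rw [← Module.finrank_eq_card_chooseBasisIndex, NumberField.RingOfIntegers.rank, finrank_Q_L]
    simp
  let b := (NumberField.RingOfIntegers.basis L).reindex e
  have hb := NumberField.discr_eq_discr L b
  have h := Algebra.discr_of_matrix_vecMul b (b.toMatrix family)
  have h2 : (b : Fin 2 × Fin 3 → 𝓞 L) ᵥ* (b.toMatrix family).map (algebraMap ℤ (𝓞 L)) =
      family := by
    ext1 a
    rw [← b.sum_toMatrix_smul_self family a]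
    simp only [Matrix.vecMul, dotProduct, Matrix.map_apply, Algebra.smul_def, mul_comm]
  rw [h2, hb, discr_family] at h
  have h3 : (b.toMatrix family).det ≠ 0 := by
    intro h0
    rw [h0] at h
    norm_num at h
  have h4 : 1 ≤ (b.toMatrix family).det ^ 2 := by
    have := sq_pos_of_ne_zero h3
    omega
  have h5 := congrArg abs h
  rw [abs_mul, abs_of_pos (by omega : 0 < (b.toMatrix family).det ^ 2)] at h5
  norm_num at h5
  nlinarith [abs_nonneg (NumberField.discr L)]

theorem minkowski_bound_lt :
    (4 / Real.pi) ^ NumberField.InfinitePlace.nrComplexPlaces L *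
      ((Nat.factorial (Module.finrank ℚ L) : ℝ) /
        (Module.finrank ℚ L : ℝ) ^ (Module.finrank ℚ L) *
        √|(NumberField.discr L : ℝ)|) < 9 := by
  have hr : NumberField.InfinitePlace.nrComplexPlaces L ≤ 3 := by
    have := NumberField.InfinitePlace.card_add_two_mul_card_eq_rank L
    rw [finrank_Q_L] at this
    omega
  have hpi := Real.pi_gt_d2
  have hpi4 := Real.pi_le_four
  -- Since 4/π ≥ 1, the bound of 3 on the number of complex places is enough.
  have h1 : (4 / Real.pi) ^ NumberField.InfinitePlace.nrComplexPlaces L ≤ 2.1 := by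
    calc _ ≤ (4 / Real.pi) ^ 3 := by
          apply pow_le_pow_right₀ _ hr
          rw [le_div_iff₀ Real.pi_pos]
          linarith
      _ ≤ (4 / 3.14) ^ 3 := by gcongr
      _ ≤ 2.1 := by norm_num
  have h2 : √|(NumberField.discr L : ℝ)| ≤ 255 := by
    apply Real.sqrt_le_iff.2 ⟨by norm_num, ?_⟩
    have : ((|NumberField.discr L| : ℤ) : ℝ) ≤ (64827 : ℤ) := by exact_mod_cast abs_discr_le
    push_cast at this
    linarith
  rw [finrank_Q_L]
  have h3 : ((Nat.factorial 6 : ℝ) / ((6 : ℕ) : ℝ) ^ 6) = 5 / 324 := by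
    norm_num [Nat.factorial]
  rw [h3]
  calc _ ≤ 2.1 * (5 / 324 * 255 : ℝ) := by gcongr
    _ < 9 := by norm_num

/-! ### Two elements of norm 7 -/

/-- The product of c plus the three conjugates of θ is −f(−c), with f the cubic. -/
theorem relNorm_add_thetaL {c : L} (hc : sigma c = c) :
    relNorm (c + thetaL) = c ^ 3 - c ^ 2 - 2 * c + 1 := by
  simp only [relNorm, map_add, hc]
  rw [sigma_sigma_thetaL, sigma_thetaL]
  linear_combination (1 - thetaL ^ 2 - c * thetaL) * thetaL_root

/-- `α` as an algebraic integer of `L`. -/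
noncomputable def alphaO : 𝓞 L := 1 + omegaO + thetaO

theorem coe_alphaO : (alphaO : L) = alpha := rfl

theorem normSq_add_mul_omega (a b : ℝ) :
    Complex.normSq (a + b * omega) = a ^ 2 - a * b + b ^ 2 := by
  have h := Complex.mul_conj (a + b * omega)
  rw [map_add, map_mul, omega_conj, Complex.conj_ofReal, Complex.conj_ofReal] at h
  have h2 : ((Complex.normSq (a + b * omega) : ℝ) : ℂ) = ((a ^ 2 - a * b + b ^ 2 : ℝ) : ℂ) := by
    rw [← h]
    push_cast
    linear_combination (-b ^ 2 : ℂ) * omega_quad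
  exact_mod_cast h2

theorem relNorm_alpha : relNorm alpha = -2 + -3 * omegaL := by
  have h : sigma (1 + omegaL) = 1 + omegaL := by rw [map_add, map_one, sigma_omegaL]
  rw [alpha, relNorm_add_thetaL h]
  linear_combination (omegaL + 1) * omegaL_quad

theorem absNorm_alphaO : Ideal.absNorm (Ideal.span {alphaO}) = 7 := by
  have h := absNorm_span_eq alphaO
  rw [coe_alphaO, relNorm_alpha] at h
  have h2 : ((-2 + -3 * omegaL : L) : ℂ) = ((-2 : ℝ) : ℂ) + ((-3 : ℝ) : ℂ) * omega := by
    push_cast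
    rfl
  rw [h2, normSq_add_mul_omega] at h
  rw [show (-2 : ℝ) ^ 2 - -2 * -3 + (-3) ^ 2 = (7 : ℕ) by norm_num] at h
  exact_mod_cast h

theorem absNorm_theta_sub_omega : Ideal.absNorm (Ideal.span {-omegaO + thetaO}) = 7 := by
  have h := absNorm_span_eq (-omegaO + thetaO)
  have h1 : relNorm ((-omegaO + thetaO : 𝓞 L) : L) = 1 + 3 * omegaL := by
    change relNorm (-omegaL + thetaL) = _
    rw [relNorm_add_thetaL (by rw [map_neg, sigma_omegaL])]
    linear_combination (-omegaL) * omegaL_quad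
  have h2 : ((1 + 3 * omegaL : L) : ℂ) = ((1 : ℝ) : ℂ) + ((3 : ℝ) : ℂ) * omega := by
    push_cast
    rfl
  rw [h1, h2, normSq_add_mul_omega] at h
  rw [show (1 : ℝ) ^ 2 - 1 * 3 + 3 ^ 2 = (7 : ℕ) by norm_num] at h
  exact_mod_cast h

/-! ### Residue fields at the primes above 7 -/

theorem exists_ringHom_zmod {p : ℕ} (hp : p.Prime) {I : Ideal (𝓞 L)} (h : Ideal.absNorm I = p) :
    ∃ f : 𝓞 L →+* ZMod p, RingHom.ker f = I := by
  have hc : Nat.card (𝓞 L ⧸ I) = p := h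
  have : Finite (𝓞 L ⧸ I) := Nat.finite_of_card_ne_zero (by rw [hc]; exact hp.ne_zero)
  have := Fintype.ofFinite (𝓞 L ⧸ I)
  rw [Nat.card_eq_fintype_card] at hc
  refine ⟨((ZMod.ringEquivOfPrime _ hp hc).symm : _ →+* ZMod p).comp (Ideal.Quotient.mk I), ?_⟩
  ext x
  rw [RingHom.mem_ker, RingHom.comp_apply]
  exact (map_eq_zero_iff _ (RingEquiv.injective _)).trans Ideal.Quotient.eq_zero_iff_mem

/-- `σ` on the ring of integers of `L`. -/
noncomputable def sigmaO : 𝓞 L ≃+* 𝓞 L := NumberField.RingOfIntegers.mapRingEquiv sigma.toRingEquiv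

theorem coe_sigmaO (x : 𝓞 L) : (sigmaO x : L) = sigma x := rfl

theorem sigmaO_omegaO : sigmaO omegaO = omegaO :=
  NumberField.RingOfIntegers.ext sigma_omegaL

theorem sigmaO_thetaO : sigmaO thetaO = thetaO ^ 2 - 2 :=
  NumberField.RingOfIntegers.ext sigma_thetaL

theorem sigmaO_cubed (x : 𝓞 L) : sigmaO (sigmaO (sigmaO x)) = x :=
  NumberField.RingOfIntegers.ext (sigma_cubed x)

/-- Modulo 7 the cubic is (t − 2)³. -/
theorem zmod7_theta {t : ZMod 7} (h : t ^ 3 + t ^ 2 - 2 * t - 1 = 0) : t = 2 := by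
  revert t; decide

theorem zmod7_omega {w : ZMod 7} (h : w ^ 2 + w + 1 = 0) : w = 2 ∨ w = 4 := by
  revert w; decide

theorem ringHom_thetaO (f : 𝓞 L →+* ZMod 7) : f thetaO = 2 := by
  have h := congrArg f thetaO_root
  simp only [map_add, map_sub, map_mul, map_pow, map_one, map_ofNat, map_zero] at h
  exact zmod7_theta h

theorem ringHom_omegaO (f : 𝓞 L →+* ZMod 7) : f omegaO = 2 ∨ f omegaO = 4 := by
  have h := congrArg f omegaO_quad
  simp only [map_add, map_pow, map_one, map_zero] at h
  exact zmod7_omega h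

/-- The tamely ramified prime `(α)` over `7`: `σ` acts trivially on its residue field. -/
theorem exists_residue_hom : ∃ f : 𝓞 L →+* ZMod 7, RingHom.ker f = Ideal.span {alphaO} ∧
    f omegaO = 4 ∧ ∀ x, f (sigmaO x) = f x := by
  obtain ⟨f, hf⟩ := exists_ringHom_zmod (p := 7) (by norm_num) absNorm_alphaO
  have ht := ringHom_thetaO f
  have ha : f alphaO = 0 := by
    rw [← RingHom.mem_ker, hf]
    exact Ideal.mem_span_singleton_self _
  have hw : f omegaO = 4 := by
    have h : f alphaO = 1 + f omegaO + f thetaO := by simp [alphaO]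
    rw [ha, ht] at h
    generalize f omegaO = w at h
    revert w; decide
  refine ⟨f, hf, hw, ?_⟩
  -- It suffices to test the generator: σ(α) = 1 + ω + θ² − 2 maps to 1 + 4 + 4 − 2 = 0.
  have hker : RingHom.ker f ≤ RingHom.ker (f.comp (sigmaO : 𝓞 L →+* 𝓞 L)) := by
    rw [hf, Ideal.span_singleton_le_iff_mem, RingHom.mem_ker]
    change f (sigmaO alphaO) = 0
    simp only [alphaO, map_add, map_one, sigmaO_omegaO, sigmaO_thetaO, map_sub, map_pow, map_ofNat,
      hw, ht]
    decide
  intro x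
  -- Modulo the kernel x is a rational integer, which σ fixes.
  have h0 : x - ((f x).val : 𝓞 L) ∈ RingHom.ker f := by
    rw [RingHom.mem_ker]
    simp
  have h1 := hker h0
  rw [RingHom.mem_ker, map_sub, map_natCast, ZMod.natCast_zmod_val, sub_eq_zero] at h1
  exact h1

/-! ### The cyclic algebra is a division algebra -/

/-- The reduced norm of `x₀ + x₁e + x₂e²` in the cyclic algebra `(L/K, σ, ω)`. -/
noncomputable def reducedNorm (x : Fin 3 → 𝓞 L) : 𝓞 L :=
  x 0 * sigmaO (x 0) * sigmaO (sigmaO (x 0)) + omegaO * (x 1 * sigmaO (x 1) * sigmaO (sigmaO (x 1)))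
    + omegaO ^ 2 * (x 2 * sigmaO (x 2) * sigmaO (sigmaO (x 2)))
    - omegaO * (x 0 * sigmaO (x 1) * sigmaO (sigmaO (x 2))
      + x 1 * sigmaO (x 2) * sigmaO (sigmaO (x 0)) + x 2 * sigmaO (x 0) * sigmaO (sigmaO (x 1)))

/-- Scaling the coordinates by b is left multiplication by b in the algebra, and Nrd(b) =
N_{L/K}(b). -/
theorem reducedNorm_smul (b : 𝓞 L) (y : Fin 3 → 𝓞 L) :
    reducedNorm (b • y) = b * sigmaO b * sigmaO (sigmaO b) * reducedNorm y := by
  simp only [reducedNorm, Pi.smul_apply, smul_eq_mul, map_mul]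
  ring

theorem sigmaO_reducedNorm (x : Fin 3 → 𝓞 L) : sigmaO (reducedNorm x) = reducedNorm x := by
  simp only [reducedNorm, map_sub, map_add, map_mul, map_pow, sigmaO_cubed, sigmaO_omegaO]
  ring

/-- This is the norm form of 𝔽₇[t]/(t³ − 4), a field because the nonzero cubes modulo 7 are ±1. -/
theorem zmod7_norm_form {a b c : ZMod 7} (h : a * a * a + 4 * (b * b * b) + 4 ^ 2 * (c * c * c)
    - 4 * (a * b * c + b * c * a + c * a * b) = 0) : a = 0 ∧ b = 0 ∧ c = 0 := by
  revert a b c; decide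

theorem alphaO_dvd {x : Fin 3 → 𝓞 L} (h : reducedNorm x = 0) (l : Fin 3) : alphaO ∣ x l := by
  obtain ⟨f, hf, hw, hs⟩ := exists_residue_hom
  have h1 := congrArg f h
  simp only [reducedNorm, map_sub, map_add, map_mul, map_pow, hs, hw, map_zero] at h1
  obtain ⟨h0, h1, h2⟩ := zmod7_norm_form h1
  rw [← Ideal.mem_span_singleton, ← hf, RingHom.mem_ker]
  fin_cases l <;> assumption

theorem alphaO_ne_zero : alphaO ≠ 0 := by
  intro h
  have := absNorm_alphaO
  rw [h] at this
  simp at this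

theorem alphaO_not_isUnit : ¬ IsUnit alphaO := by
  intro h
  have := absNorm_alphaO
  rw [Ideal.span_singleton_eq_top.2 h] at this
  simp at this

/-- Infinite descent: dividing a zero of the reduced norm by α gives another zero. -/
theorem alphaO_pow_dvd (n : ℕ) : ∀ {x : Fin 3 → 𝓞 L}, reducedNorm x = 0 →
    ∀ l, alphaO ^ n ∣ x l := by
  induction n with
  | zero => intro x _ l; simp
  | succ n ih =>
    intro x hx l
    choose y hy using alphaO_dvd hx
    have hxy : x = alphaO • y := funext hy
    rw [hxy, reducedNorm_smul] at hx
    have hy0 : reducedNorm y = 0 := by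
      refine (mul_eq_zero.1 hx).resolve_left ?_
      simp [alphaO_ne_zero]
    rw [hy l, pow_succ']
    exact mul_dvd_mul_left _ (ih hy0 l)

theorem reducedNorm_ne_zero {x : Fin 3 → 𝓞 L} (hx : x ≠ 0) : reducedNorm x ≠ 0 := by
  intro h
  apply hx
  ext1 l
  by_contra hl
  obtain ⟨n, hn⟩ := FiniteMultiplicity.of_not_isUnit alphaO_not_isUnit hl
  exact hn (alphaO_pow_dvd _ h l)

/-- The reduced norm n is fixed by σ, so its relative norm is n³ and |n|⁶ is the norm of the nonzero
ideal (n). -/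
theorem one_le_normSq_reducedNorm {x : Fin 3 → 𝓞 L} (hx : x ≠ 0) :
    1 ≤ Complex.normSq ((reducedNorm x : L) : ℂ) := by
  set n := reducedNorm x with hn
  have hs : sigma (n : L) = n := by
    rw [← coe_sigmaO, hn, sigmaO_reducedNorm]
  have h := absNorm_span_eq n
  rw [relNorm, hs, hs] at h
  have h2 : Ideal.absNorm (Ideal.span {n}) ≠ 0 := by
    rw [Ne, Ideal.absNorm_eq_zero_iff, Ideal.span_singleton_eq_bot]
    exact reducedNorm_ne_zero hx
  have h3 : (1 : ℝ) ≤ Ideal.absNorm (Ideal.span {n}) := by exact_mod_cast Nat.one_le_iff_ne_zero.2 h2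
  rw [h] at h3
  push_cast at h3
  rw [map_mul, map_mul] at h3
  by_contra hlt
  push Not at hlt
  have := Complex.normSq_nonneg ((n : L) : ℂ)
  have h4 : (Complex.normSq ((n : L) : ℂ)) ^ 3 < 1 := pow_lt_one₀ this hlt (by norm_num)
  nlinarith

/-! ### `𝓞 L` is principal -/

/-- A finite field containing both a root of `X² + X + 1` and a root of `X³ + X² - 2X - 1` has
`7` or at least `9` elements. -/
theorem card_eq_seven_of_lt_nine {F : Type*} [Field F] [Fintype F] {w t : F}
    (hw : w ^ 2 + w + 1 = 0) (ht : t ^ 3 + t ^ 2 - 2 * t - 1 = 0) (h9 : Fintype.card F < 9) :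
    Fintype.card F = 7 := by
  have h1 : 1 < Fintype.card F := Fintype.one_lt_card
  have h0 := FiniteField.cast_card_eq_zero F
  have hpt := FiniteField.pow_card t
  have hpw := FiniteField.pow_card w
  have hpp := FiniteField.isPrimePow_card F
  generalize Fintype.card F = n at *
  -- The quadratic has no root in 𝔽₂ or 𝔽₈, and the cubic has none in 𝔽₄.
  have two : (2 : F) = 0 → n = 2 ∨ n = 4 ∨ n = 8 → False := by
    rintro h2 (rfl | rfl | rfl)
    · grind
    · grind
    · grind
  interval_cases n
  · exact (two (by exact_mod_cast h0) (by simp)).elim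
  · push_cast at h0
    grind
  · refine (two ?_ (by simp)).elim
    have : (2 : F) ^ 2 = 0 := by push_cast at h0; linear_combination h0
    exact pow_eq_zero_iff (by norm_num) |>.1 this
  · push_cast at h0
    -- In 𝔽₅, w⁵ = w² = −1 − w must equal w, so the discriminant −3 would vanish.
    have h1 : 2 * w + 1 = 0 := by linear_combination (w ^ 3 - w ^ 2 + 1) * hw - hpw
    have h3 : (3 : F) = 0 := by linear_combination 4 * hw - (2 * w + 1) * h1
    exact absurd (by linear_combination 2 * h3 - h0 : (1 : F) = 0) one_ne_zero
  · exact absurd hpp (by decide)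
  · rfl
  · refine (two ?_ (by simp)).elim
    have : (2 : F) ^ 3 = 0 := by push_cast at h0; linear_combination h0
    exact pow_eq_zero_iff (by norm_num) |>.1 this

theorem eq_of_le_of_absNorm_eq {I J : Ideal (𝓞 L)} (h : I ≤ J)
    (hn : Ideal.absNorm I = Ideal.absNorm J) (h0 : Ideal.absNorm J ≠ 0) : I = J := by
  obtain ⟨C, rfl⟩ := Ideal.dvd_iff_le.2 h
  rw [map_mul] at hn
  have : Ideal.absNorm C = 1 := by
    have := Nat.pos_of_ne_zero h0
    nlinarith
  rw [Ideal.absNorm_eq_one_iff.1 this, Ideal.mul_top]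

/-- Modulo P, θ is 2 and ω is 2 or 4, so P contains θ − ω or α. Either has norm 7, hence generates
P. -/
theorem isPrincipal_of_absNorm_eq_seven {P : Ideal (𝓞 L)} (h : Ideal.absNorm P = 7) :
    Submodule.IsPrincipal P := by
  obtain ⟨f, hf⟩ := exists_ringHom_zmod (p := 7) (by norm_num) h
  have ht := ringHom_thetaO f
  have key : ∀ a, f a = 0 → Ideal.absNorm (Ideal.span {a}) = 7 → Submodule.IsPrincipal P := by
    intro a ha hn
    refine ⟨a, ?_⟩
    refine (eq_of_le_of_absNorm_eq (I := Ideal.span {a}) ?_ (by rw [hn, h]) (by simp [h])).symm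
    rwa [Ideal.span_singleton_le_iff_mem, ← hf, RingHom.mem_ker]
  rcases ringHom_omegaO f with hw | hw
  · refine key (-omegaO + thetaO) ?_ absNorm_theta_sub_omega
    rw [map_add, map_neg, hw, ht]
    decide
  · refine key alphaO ?_ absNorm_alphaO
    rw [alphaO, map_add, map_add, map_one, hw, ht]
    decide

instance : IsPrincipalIdealRing (𝓞 L) := by
  apply RingOfIntegers.isPrincipalIdealRing_of_isPrincipal_of_norm_le_of_isPrime
  intro I hI hn
  have h9 : Ideal.absNorm (I : Ideal (𝓞 L)) < 9 := by
    exact_mod_cast hn.trans_lt minkowski_bound_lt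
  have h0 : Ideal.absNorm (I : Ideal (𝓞 L)) ≠ 0 := Ideal.absNorm_ne_zero_of_nonZeroDivisors I
  apply isPrincipal_of_absNorm_eq_seven
  have hfin : Finite (𝓞 L ⧸ (I : Ideal (𝓞 L))) := Nat.finite_of_card_ne_zero h0
  have := Fintype.ofFinite (𝓞 L ⧸ (I : Ideal (𝓞 L)))
  have hmax : (I : Ideal (𝓞 L)).IsMaximal :=
    hI.isMaximal (nonZeroDivisors.coe_ne_zero I)
  let _ := Ideal.Quotient.field (I : Ideal (𝓞 L))
  have hc : Ideal.absNorm (I : Ideal (𝓞 L)) = Fintype.card (𝓞 L ⧸ (I : Ideal (𝓞 L))) := by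
    rw [← Nat.card_eq_fintype_card]
    rfl
  rw [hc] at h9 ⊢
  refine card_eq_seven_of_lt_nine (w := Ideal.Quotient.mk _ omegaO)
    (t := Ideal.Quotient.mk _ thetaO) ?_ ?_ h9
  · simpa using congrArg (Ideal.Quotient.mk (I : Ideal (𝓞 L))) omegaO_quad
  · simpa [map_ofNat (Ideal.Quotient.mk (I : Ideal (𝓞 L))) 2] using
      congrArg (Ideal.Quotient.mk (I : Ideal (𝓞 L))) thetaO_root

/-! ### Determinants of codewords and of translated lattices -/

theorem normSq_relNorm_alpha : Complex.normSq (relNorm alpha : ℂ) = 7 := by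
  have h := absNorm_span_eq alphaO
  rw [absNorm_alphaO, coe_alphaO] at h
  exact_mod_cast h.symm

theorem codeword_sub (x y : Fin 3 → 𝓞 L) : codeword x - codeword y = codeword (x - y) := by
  rw [codeword, codeword, codeword, ← Matrix.mul_sub]
  congr 1
  ext i j
  fin_cases i <;> fin_cases j <;> simp [layerMatrix, mul_sub]

theorem det_codeword (x : Fin 3 → 𝓞 L) :
    (codeword x).det = (relNorm alpha : ℂ) * ((reducedNorm x : L) : ℂ) := by
  have h : ((reducedNorm x : L) : ℂ) = (layerMatrix fun l => (x l : L)).det := by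
    have ho : ((omegaO : L) : ℂ) = omega := rfl
    rw [layerMatrix, Matrix.det_fin_three]
    simp only [reducedNorm, map_add, map_sub, map_mul, map_pow, coe_sigmaO, AddSubgroupClass.coe_sub,
      AddMemClass.coe_add, MulMemClass.coe_mul, SubmonoidClass.coe_pow, ho]
    simp
    ring
  rw [codeword, Matrix.det_mul, Matrix.det_diagonal, h, Fin.prod_univ_three]
  rfl

theorem det_mul_conjTranspose_codeword (x : Fin 3 → 𝓞 L) :
    (codeword x * (codeword x)ᴴ).det =
      ((7 * Complex.normSq ((reducedNorm x : L) : ℂ) : ℝ) : ℂ) := by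
  rw [Matrix.det_mul, Matrix.det_conjTranspose, det_codeword, ← starRingEnd_apply, Complex.mul_conj,
    Complex.normSq_mul, normSq_relNorm_alpha]

theorem codeword_injective : Function.Injective codeword := by
  intro x y h
  by_contra hne
  have h1 := one_le_normSq_reducedNorm (sub_ne_zero.2 hne)
  have h2 := det_mul_conjTranspose_codeword (x - y)
  rw [← codeword_sub, h, sub_self, zero_mul, Matrix.det_zero, eq_comm, Complex.ofReal_eq_zero] at h2
  linarith

/-- The translated lattice of the matrices `codeword x` with all `x l` congruent to `c l` modulo
the ideal `I`. -/
def cosetCode (I : Ideal (𝓞 L)) (c : Fin 3 → 𝓞 L) : Set (Matrix (Fin 3) (Fin 3) ℂ) :=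
  {X | ∃ x : Fin 3 → 𝓞 L, (∀ l, x l - c l ∈ I) ∧ X = codeword x}

theorem normSq_reducedNorm_smul (b : 𝓞 L) (y : Fin 3 → 𝓞 L) :
    Complex.normSq ((reducedNorm (b • y) : L) : ℂ) =
      Ideal.absNorm (Ideal.span {b}) * Complex.normSq ((reducedNorm y : L) : ℂ) := by
  rw [absNorm_span_eq, reducedNorm_smul, ← Complex.normSq_mul]
  rfl

/-- The minimum determinant of a translate of the lattice of an ideal is proportional to the norm
of the ideal. -/
theorem isLeast_pairDets_cosetCode {I : Ideal (𝓞 L)} (hI : I ≠ ⊥) (c : Fin 3 → 𝓞 L) :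
    IsLeast (pairDets (cosetCode I c)) (7 * Ideal.absNorm I) := by
  obtain ⟨b, rfl⟩ := IsPrincipalIdealRing.principal I
  have hb : b ≠ 0 := by
    rintro rfl
    simp at hI
  constructor
  -- The minimum is attained at the difference b · 1, as Nrd(1) = 1.
  · refine ⟨codeword (c + b • Pi.single 0 1), ⟨_, fun l => ?_, rfl⟩, codeword c,
      ⟨c, fun l => by simp, rfl⟩, fun h => ?_, ?_⟩
    · simpa using Ideal.mul_mem_right _ _ (Ideal.mem_span_singleton_self b)
    · have h1 := congrFun (codeword_injective h) 0
      simp [hb] at h1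
    · rw [codeword_sub, add_sub_cancel_left, det_mul_conjTranspose_codeword,
        normSq_reducedNorm_smul]
      have h1 : reducedNorm (Pi.single 0 1) = 1 := by simp [reducedNorm]
      rw [h1]
      simp
  · rintro d ⟨_, ⟨x, hx, rfl⟩, _, ⟨y, hy, rfl⟩, hne, hd⟩
    have hdvd : ∀ l, b ∣ x l - y l := fun l => by
      rw [← Ideal.mem_span_singleton]
      have := Ideal.sub_mem _ (hx l) (hy l)
      rwa [sub_sub_sub_cancel_right] at this
    choose z hz using hdvd
    have hxy : x - y = b • z := funext hz
    rw [codeword_sub, hxy, det_mul_conjTranspose_codeword, normSq_reducedNorm_smul,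
      Complex.ofReal_inj] at hd
    have hz0 : z ≠ 0 := by
      rintro rfl
      rw [smul_zero, sub_eq_zero] at hxy
      exact hne (by rw [hxy])
    have h1 := one_le_normSq_reducedNorm hz0
    rw [hd]
    have h2 : (0 : ℝ) ≤ Ideal.absNorm (Ideal.span {b}) := Nat.cast_nonneg _
    have h3 := mul_le_mul_of_nonneg_left h1 h2
    rw [mul_one] at h3
    exact mul_le_mul_of_nonneg_left h3 (by norm_num)

/-! ### Side information as a coset of an ideal -/

section Scheme

variable {k : ℕ} {q : Fin k → Ideal (𝓞 L)} (e : (∀ i, 𝓞 L ⧸ q i) ≃+* 𝓞 L ⧸ ∏ i, q i)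
  (S : Finset (Fin k))

/-- The ring homomorphism taking a layer signal to its sub-messages with index in `S`. -/
noncomputable def messageHom : 𝓞 L →+* ∀ i : S, 𝓞 L ⧸ q i :=
  RingHom.pi fun i : S => ((Pi.evalRingHom (fun i => 𝓞 L ⧸ q i) i.1).comp
    (e.symm : (𝓞 L ⧸ ∏ i, q i) →+* ∀ i, 𝓞 L ⧸ q i)).comp (Ideal.Quotient.mk (∏ i, q i))

theorem messageHom_apply (x : 𝓞 L) (i : S) :
    messageHom e S x i = e.symm (Ideal.Quotient.mk (∏ i, q i) x) i := rfl

theorem exists_forall_symm_mk_eq (t : ∀ i, 𝓞 L ⧸ q i) :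
    ∃ x : 𝓞 L, ∀ i, e.symm (Ideal.Quotient.mk (∏ i, q i) x) i = t i := by
  obtain ⟨x, hx⟩ := Ideal.Quotient.mk_surjective (e t)
  exact ⟨x, fun i => by rw [hx, RingEquiv.symm_apply_apply]⟩

theorem messageHom_surjective : Function.Surjective (messageHom e S) := by
  intro t
  -- Components outside S are free; 0 is an arbitrary choice.
  obtain ⟨x, hx⟩ := exists_forall_symm_mk_eq e fun i => if h : i ∈ S then t ⟨i, h⟩ else 0
  refine ⟨x, funext fun i => ?_⟩
  rw [messageHom_apply, hx, dif_pos i.2]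

/-- First isomorphism theorem. Only the index of the kernel matters, so `e` may be any ring
isomorphism and the kernel need not be identified. -/
theorem absNorm_ker_messageHom :
    Ideal.absNorm (RingHom.ker (messageHom e S)) = ∏ i ∈ S, Ideal.absNorm (q i) := by
  have h := Nat.card_congr
    (RingHom.quotientKerEquivOfSurjective (messageHom_surjective e S)).toEquiv
  rw [Nat.card_pi, Finset.prod_coe_sort S fun i => Nat.card (𝓞 L ⧸ q i)] at h
  exact h

/-- Any preimage c of the side information, layer by layer, serves as the translation. -/
theorem exists_latticeSubcode_eq (v : ∀ i, Message q i) :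
    ∃ c, latticeSubcode q e S v = cosetCode (RingHom.ker (messageHom e S)) c := by
  choose c hc using fun l => exists_forall_symm_mk_eq e fun i => v i l
  refine ⟨c, Set.ext fun X => exists_congr fun x => and_congr_left fun _ => ?_⟩
  simp only [RingHom.mem_ker, map_sub, sub_eq_zero, funext_iff, messageHom_apply, hc]
  exact ⟨fun h l i => h i i.2 l, fun h i hi l => h l ⟨i, hi⟩⟩

end Scheme

/-! ### Rates and the gain -/

section Gain

variable {k : ℕ} {q : Fin k → Ideal (𝓞 L)}

theorem ker_messageHom_ne_bot (hq0 : ∀ i, q i ≠ ⊥)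
    (e : (∀ i, 𝓞 L ⧸ q i) ≃+* 𝓞 L ⧸ ∏ i, q i) (S : Finset (Fin k)) :
    RingHom.ker (messageHom e S) ≠ ⊥ := by
  rw [Ne, ← Ideal.absNorm_eq_zero_iff, absNorm_ker_messageHom, Finset.prod_eq_zero_iff]
  rintro ⟨i, _, hi⟩
  exact hq0 i (Ideal.absNorm_eq_zero_iff.1 hi)

theorem isLeast_pairDets_latticeSubcode (hq0 : ∀ i, q i ≠ ⊥)
    (e : (∀ i, 𝓞 L ⧸ q i) ≃+* 𝓞 L ⧸ ∏ i, q i) (S : Finset (Fin k)) (v : ∀ i, Message q i) :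
    IsLeast (pairDets (latticeSubcode q e S v)) (7 * (∏ i ∈ S, Ideal.absNorm (q i) : ℕ)) := by
  obtain ⟨c, hc⟩ := exists_latticeSubcode_eq e S v
  rw [hc, ← absNorm_ker_messageHom e S]
  exact isLeast_pairDets_cosetCode (ker_messageHom_ne_bot hq0 e S) c

theorem minDet_latticeSubcode (hq0 : ∀ i, q i ≠ ⊥)
    (e : (∀ i, 𝓞 L ⧸ q i) ≃+* 𝓞 L ⧸ ∏ i, q i) (S : Finset (Fin k)) (v : ∀ i, Message q i) :
    minDet (latticeSubcode q e S v) = 7 * (∏ i ∈ S, Ideal.absNorm (q i) : ℕ) :=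
  (isLeast_pairDets_latticeSubcode hq0 e S v).csInf_eq

theorem one_lt_prod_absNorm (hq0 : ∀ i, q i ≠ ⊥) {S : Finset (Fin k)} (hS : ∃ s ∈ S, q s ≠ ⊤) :
    1 < ∏ i ∈ S, Ideal.absNorm (q i) := by
  have h1 : ∀ i, 1 ≤ Ideal.absNorm (q i) := fun i =>
    Nat.one_le_iff_ne_zero.2 (mt Ideal.absNorm_eq_zero_iff.1 (hq0 i))
  obtain ⟨s, hs, hst⟩ := hS
  have h2 : 1 < Ideal.absNorm (q s) :=
    lt_of_le_of_ne (h1 s) (Ne.symm (mt Ideal.absNorm_eq_one_iff.1 hst))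
  exact h2.trans_le (Nat.le_of_dvd (Finset.prod_pos fun i _ => h1 i)
    (Finset.dvd_prod_of_mem (fun i => Ideal.absNorm (q i)) hs))

/-- Three layers over 18 real symbols leave the factor 1/6. -/
theorem rate_eq (hq0 : ∀ i, q i ≠ ⊥) (S : Finset (Fin k)) :
    rate q S = Real.logb 2 (∏ i ∈ S, Ideal.absNorm (q i) : ℕ) / 6 := by
  rw [rate, Nat.cast_prod, Real.logb_prod, Finset.sum_div]
  · refine Finset.sum_congr rfl fun i _ => ?_
    have h : Nat.card (Message q i) = Ideal.absNorm (q i) ^ 3 := by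
      rw [Message, Nat.card_fun, Nat.card_fin]
      rfl
    rw [h, Nat.cast_pow, Real.logb_pow]
    push_cast
    ring
  · intro i _
    exact_mod_cast mt Ideal.absNorm_eq_zero_iff.1 (hq0 i)

theorem encode_injective (e : (∀ i, 𝓞 L ⧸ q i) ≃+* 𝓞 L ⧸ ∏ i, q i)
    {lead : 𝓞 L ⧸ ∏ i, q i → 𝓞 L} (hlead : ∀ c, Ideal.Quotient.mk (∏ i, q i) (lead c) = c) :
    Function.Injective (encode q e lead) := by
  intro w w' h
  funext i l
  have h1 := congrFun (codeword_injective h) l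
  have h2 := congrArg (Ideal.Quotient.mk (∏ i, q i)) h1
  rw [hlead, hlead] at h2
  exact congrFun (e.injective h2) i

theorem subcode_subset_latticeSubcode (e : (∀ i, 𝓞 L ⧸ q i) ≃+* 𝓞 L ⧸ ∏ i, q i)
    {lead : 𝓞 L ⧸ ∏ i, q i → 𝓞 L} (hlead : ∀ c, Ideal.Quotient.mk (∏ i, q i) (lead c) = c)
    (S : Finset (Fin k)) (v : ∀ i, Message q i) :
    subcode q e lead S v ⊆ latticeSubcode q e S v := by
  rintro _ ⟨d, hd, rfl⟩
  refine ⟨_, fun i hi l => ?_, rfl⟩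
  rw [hlead, RingEquiv.symm_apply_apply, hd i hi]

theorem gain_latticeSubcode (hq0 : ∀ i, q i ≠ ⊥)
    (e : (∀ i, 𝓞 L ⧸ q i) ≃+* 𝓞 L ⧸ ∏ i, q i) {S : Finset (Fin k)} (hS : ∃ s ∈ S, q s ≠ ⊤)
    (v : ∀ i, Message q i) :
    gain (latticeSubcode q e ∅ v) (latticeSubcode q e S v) (rate q S) = 20 * Real.logb 10 2 := by
  rw [gain, minDet_latticeSubcode hq0, minDet_latticeSubcode hq0, rate_eq hq0, Finset.prod_empty]
  -- This makes log N nonzero, so it cancels in 10 log₁₀ N / (3 · log₂ N / 6).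
  have h1 : (1 : ℝ) < (∏ i ∈ S, Ideal.absNorm (q i) : ℕ) := by
    exact_mod_cast one_lt_prod_absNorm hq0 hS
  generalize ((∏ i ∈ S, Ideal.absNorm (q i) : ℕ) : ℝ) = N at h1
  have hN := Real.log_pos h1
  have h2 := Real.log_pos (by norm_num : (1 : ℝ) < 2)
  have h10 := Real.log_pos (by norm_num : (1 : ℝ) < 10)
  rw [Nat.cast_one, mul_one, mul_div_cancel_left₀ _ (by norm_num : (7 : ℝ) ≠ 0)]
  simp only [Real.logb]
  field_simp
  norm_num

end Gain

end PerfectCode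

theorem mainTheorem4 (k : ℕ) (q : Fin k → Ideal (𝓞 PerfectCode.L))
    (hq0 : ∀ i, q i ≠ ⊥) (hq : Pairwise fun i j => IsCoprime (q i) (q j))
    (e : (∀ i, 𝓞 PerfectCode.L ⧸ q i) ≃+* 𝓞 PerfectCode.L ⧸ ∏ i, q i)
    (lead : 𝓞 PerfectCode.L ⧸ ∏ i, q i → 𝓞 PerfectCode.L)
    (hlead : ∀ c, Ideal.Quotient.mk (∏ i, q i) (lead c) = c)
    (S : Finset (Fin k)) (hS : ∃ s ∈ S, q s ≠ ⊤)
    (v : ∀ i, PerfectCode.Message q i) :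
    Function.Injective (PerfectCode.encode q e lead) ∧
    PerfectCode.subcode q e lead ∅ v ⊆ PerfectCode.latticeSubcode q e ∅ v ∧
    PerfectCode.subcode q e lead S v ⊆ PerfectCode.latticeSubcode q e S v ∧
    IsLeast (PerfectCode.pairDets (PerfectCode.latticeSubcode q e ∅ v))
      (PerfectCode.minDet (PerfectCode.latticeSubcode q e ∅ v)) ∧
    IsLeast (PerfectCode.pairDets (PerfectCode.latticeSubcode q e S v))
      (PerfectCode.minDet (PerfectCode.latticeSubcode q e S v)) ∧
    0 < PerfectCode.minDet (PerfectCode.latticeSubcode q e ∅ v) ∧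
    0 < PerfectCode.rate q S ∧
    PerfectCode.gain (PerfectCode.latticeSubcode q e ∅ v)
      (PerfectCode.latticeSubcode q e S v) (PerfectCode.rate q S) = 20 * Real.logb 10 2 ∧
    (PerfectCode.minDet (PerfectCode.subcode q e lead ∅ v) =
        PerfectCode.minDet (PerfectCode.latticeSubcode q e ∅ v) →
      PerfectCode.minDet (PerfectCode.subcode q e lead S v) =
        PerfectCode.minDet (PerfectCode.latticeSubcode q e S v) →
      PerfectCode.gain (PerfectCode.subcode q e lead ∅ v) (PerfectCode.subcode q e lead S v)
        (PerfectCode.rate q S) = 20 * Real.logb 10 2) := by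
  refine ⟨PerfectCode.encode_injective e hlead,
    PerfectCode.subcode_subset_latticeSubcode e hlead ∅ v,
    PerfectCode.subcode_subset_latticeSubcode e hlead S v, ?_, ?_, ?_, ?_,
    PerfectCode.gain_latticeSubcode hq0 e hS v, fun h0 h1 => ?_⟩
  · rw [PerfectCode.minDet_latticeSubcode hq0]
    exact PerfectCode.isLeast_pairDets_latticeSubcode hq0 e ∅ v
  · rw [PerfectCode.minDet_latticeSubcode hq0]
    exact PerfectCode.isLeast_pairDets_latticeSubcode hq0 e S v
  · rw [PerfectCode.minDet_latticeSubcode hq0, Finset.prod_empty]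
    norm_num
  · rw [PerfectCode.rate_eq hq0]
    have h : (1 : ℝ) < (∏ i ∈ S, Ideal.absNorm (q i) : ℕ) := by
      exact_mod_cast PerfectCode.one_lt_prod_absNorm hq0 hS
    exact div_pos (Real.logb_pos (by norm_num) h) (by norm_num)
  · rw [PerfectCode.gain, h0, h1]
    exact PerfectCode.gain_latticeSubcode hq0 e hS v
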